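/- Let $d\ge 2$. Let $B=(B_{j,m})_{j,m=1}^d$ be a magnetic field on $\mathbb{R}^d$, i.e. a measurable function with values in the antisymmetric real $d\times d$ matrices, put $\widetilde B(x)_j=\sum_{m}B_{j,m}(x)x_m$, and suppose that $|x|^{2-d}\,\log_+^2(R/|x|)\,|\widetilde B(x)|^2$ is locally integrable for every $R>0$. Let $A(x)=\int_0^1\widetilde B(tx)\,dt$ be the vector potential in the Poincaré gauge, $P=-i\nabla$, and $\mathcal D(P-A)=\{\varphi\in L^2(\mathbb{R}^d):(P-A)\varphi\in L^2\}$, with $(P-A)\varphi$ taken in the sense of distributions. Let $V=V_1+V_2$ with $V_1,V_2$ real-valued and locally integrable. Expressions at infinity are understood up to null sets; in particular $\limsup_{|x|\to\infty}f(x)=\lim_{R\to\infty}\operatorname{ess\,sup}_{|x|\ge R}f$. Suppose that $\widetilde B^2$, $V$, $V_1$, $xV_1$ and $x\cdot\nabla V_2$ are bounded outside a compact set (for $x\cdot\nabla V_2$ this means that, outside a compact set, this distribution is a bounded function), and that $\lim_{|x|\to\infty}V(x)=\lim_{|x|\to\infty}V_1(x)=0$. Then the following hold. (a) (Vanishing at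 infinity.) $V$ and $V_1$ vanish at infinity with respect to $(P-A)^2$. Here a potential $W$ is said to vanish at infinity if there are $R_0>0$ and positive $\alpha_R,\gamma_R$ ($R\ge R_0$), tending to $0$ as $R\to\infty$, such that for all $R\ge R_0$ and all $\varphi\in\mathcal D(P-A)$ with $\operatorname{supp}\varphi\subset\{|x|\ge R\}$ the function $W|\varphi|^2$ is integrable and $|\langle\varphi,W\varphi\rangle|\le\alpha_R\|(P-A)\varphi\|_2^2+\gamma_R\|\varphi\|_2^2$. (b) (Boundedness at infinity.) There are positive sequences $\varepsilon_j\to0$, $R_j\to\infty$ and decreasing positive sequences $\beta_j\to\beta$, $\omega_{1,j}\to\omega_1$, $\omega_{2,j}\to\omega_2$ such that for all $j$ and all $\varphi\in\mathcal D(P-A)$ with $\operatorname{supp}\varphi\subset\{|x|\ge R_j\}$ $$\|\widetilde B\varphi\|_2^2\le\varepsilon_j\|(P-A)\varphi\|_2^2+\beta_j^2\|\varphi\|_2^2,\qquad \|xV_1\varphi\|_2^2\le\varepsilon_j\|(P-A)\varphi\|_2^2+\omega_{1,j}^2\|\varphi\|_2^2,$$ $$\langle\varphi,x\cdot\nabla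 V_2\,\varphi\rangle\le\varepsilon_j\|(P-A)\varphi\|_2^2+\omega_{2,j}\|\varphi\|_2^2 ,$$ and one can take $$\beta\le\limsup_{|x|\to\infty}|\widetilde B(x)|,\qquad \omega_1\le\limsup_{|x|\to\infty}|xV_1(x)|,\qquad \omega_2\le\limsup_{|x|\to\infty}(x\cdot\nabla V_2(x))_+ .$$ Here $\langle\varphi,x\cdot\nabla V_2\,\varphi\rangle$ is the extension, continuous in the graph norm of $P-A$ and defined on those $\varphi\in\mathcal D(P-A)$ which are supported sufficiently far out, of the form $-d\langle\varphi,V_2\varphi\rangle-2\operatorname{Re}\langle V_2\varphi,x\cdot\nabla\varphi\rangle$ on test functions $\varphi\in C_0^\infty$ supported there; part of the claim is that this extension exists. (c) In the same way $\widetilde B^2$ and $(xV_1)^2$ are bounded at infinity and $x\cdot\nabla V_2$ is bounded from above at infinity with respect to $(P-A)^2$, and the same three upper bounds hold for the asymptotic bounds $\beta=\gamma_\infty(\widetilde B^2)^{1/2}$, $\omega_1=\gamma_\infty((xV_1)^2)^{1/2}$ and $\omega_2=\gamma^+_\infty(x\cdot\nabla V_2)$. Here $W$ is bounded from above at infinity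 if there are $R_0>0$, positive $\alpha_R\to0$ and positive decreasing $\gamma_R$ with $\langle\varphi,W\varphi\rangle\le\alpha_R\|(P-A)\varphi\|_2^2+\gamma_R\|\varphi\|_2^2$ for all $R\ge R_0$ and all $\varphi\in\mathcal D(P-A)$ with $\operatorname{supp}\varphi\subset\{|x|\ge R\}$ (all such $\varphi$ being in the form domain of $W$); $\gamma^+_\infty(W)$ is the infimum of the possible limits $\lim_{R\to\infty}\gamma_R$; $W$ is bounded at infinity if $\pm W$ are bounded from above at infinity, and $\gamma_\infty(W)=\max(\gamma^+_\infty(W),\gamma^+_\infty(-W))$. -/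

import Mathlib

open MeasureTheory Filter Topology
open scoped ContDiff

noncomputable section

namespace MagneticForms

/-- The configuration space `ℝ^d` with its Euclidean norm. -/
abbrev E (d : ℕ) : Type := EuclideanSpace ℝ (Fin d)

/-- The vector field `B̃(x) = B(x)[x]`, that is `B̃(x)_j = ∑ₘ B_{j,m}(x) xₘ`. -/
def tildeB {d : ℕ} (B : E d → Matrix (Fin d) (Fin d) ℝ) (x : E d) : E d :=
  WithLp.toLp 2 fun j => ∑ m, B x j m * x m

/-- The vector potential of `B` in the Poincaré gauge, `A(x) = ∫₀¹ B(tx)[tx] dt`. -/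
def poincareGauge {d : ℕ} (B : E d → Matrix (Fin d) (Fin d) ℝ) (x : E d) : E d :=
  ∫ t in (0 : ℝ)..1, tildeB B (t • x)

/-- The mild integrability condition on a magnetic field under which the Poincaré gauge potential
is well defined almost everywhere and locally square integrable:
`|x|^{2-d} log₊(R/|x|)² |B̃(x)|²` is locally integrable for all `R > 0`. -/
def MildlyIntegrable {d : ℕ} (B : E d → Matrix (Fin d) (Fin d) ℝ) : Prop :=
  ∀ R : ℝ, 0 < R → LocallyIntegrable
    (fun x : E d => ‖x‖ ^ (2 - (d : ℤ)) * Real.posLog (R / ‖x‖) ^ 2 * ‖tildeB B x‖ ^ 2) volume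

/-- Complex valued test functions, `C₀^∞(ℝ^d)`. -/
def IsTestFunction {d : ℕ} (η : E d → ℂ) : Prop :=
  ContDiff ℝ ∞ η ∧ HasCompactSupport η

/-- `φ ∈ 𝒟(P - A)` and `ψ = (P - A)φ`, where `P = -i∇`: both are square integrable and the
equation `(P_j - A_j) φ = ψ_j` holds in the sense of distributions. The vector field `ψ` is
determined by `φ` up to null sets. -/
structure IsMagneticDerivative {d : ℕ} (A : E d → E d) (φ : E d → ℂ)
    (ψ : E d → EuclideanSpace ℂ (Fin d)) : Prop where
  memLp : MemLp φ 2 volume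
  memLp_deriv : MemLp ψ 2 volume
  weak_eq : ∀ η : E d → ℂ, IsTestFunction η → ∀ j : Fin d,
    ∫ x, ψ x j * η x =
      ∫ x, (Complex.I * (φ x * fderiv ℝ η x (EuclideanSpace.single j 1))
        - (A x j : ℂ) * φ x * η x)

/-- `supp φ ⊆ {x : |x| ≥ R}` for the support of a function defined almost everywhere. -/
def SuppOutside {d : ℕ} (R : ℝ) (φ : E d → ℂ) : Prop :=
  ∀ᵐ x : E d, ‖x‖ < R → φ x = 0

/-- The squared `L²` norm (used for square integrable functions only). -/
def normSq2 {d : ℕ} {F : Type*} [NormedAddCommGroup F] (φ : E d → F) : ℝ :=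
  ∫ x, ‖φ x‖ ^ 2

/-- `φ` lies in the quadratic form domain `𝒬(W) = 𝒟(|W|^{1/2})` of the potential `W`
(for square integrable `φ`). -/
def InFormDomain {d : ℕ} (W : E d → ℝ) (φ : E d → ℂ) : Prop :=
  Integrable (fun x => W x * ‖φ x‖ ^ 2) volume

/-- The quadratic form `⟨φ, W φ⟩` of a potential `W`, for `φ` in its form domain. -/
def potentialForm {d : ℕ} (W : E d → ℝ) (φ : E d → ℂ) : ℝ :=
  ∫ x, W x * ‖φ x‖ ^ 2

/-- The quadratic form of the distribution `x · ∇V` on test functions,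
`⟨φ, x·∇V φ⟩ = -d ⟨φ, V φ⟩ - 2 Re ⟨V φ, x·∇φ⟩`. -/
def virialForm {d : ℕ} (V : E d → ℝ) (φ : E d → ℂ) : ℝ :=
  -(d : ℝ) * potentialForm V φ
    - 2 * (∫ x, (starRingEnd ℂ) ((V x : ℂ) * φ x) * fderiv ℝ φ x x).re

/-- `q` is the extension of the quadratic form of the distribution `x · ∇V` from test functions
supported in `{|x| > R₀}` to those `φ ∈ 𝒟(P - A)` which are supported in `{|x| ≥ R}` for some
`R > R₀`: it agrees with `virialForm V` on the former and is continuous in the graph norm of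
`P - A` on the latter. As test functions are dense, there is at most one such extension. -/
structure IsVirialFormOutside {d : ℕ} (A : E d → E d) (V : E d → ℝ) (R₀ : ℝ)
    (q : (E d → ℂ) → ℝ) : Prop where
  eq_virialForm : ∀ φ : E d → ℂ, IsTestFunction φ → tsupport φ ⊆ {x | R₀ < ‖x‖} →
    q φ = virialForm V φ
  tendsto : ∀ R : ℝ, R₀ < R →
    ∀ (φ : E d → ℂ) (ψ : E d → EuclideanSpace ℂ (Fin d))
      (φs : ℕ → E d → ℂ) (ψs : ℕ → E d → EuclideanSpace ℂ (Fin d)),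
      IsMagneticDerivative A φ ψ → SuppOutside R φ →
      (∀ n, IsMagneticDerivative A (φs n) (ψs n) ∧ SuppOutside R (φs n)) →
      Tendsto (fun n => normSq2 (φs n - φ)) atTop (𝓝 0) →
      Tendsto (fun n => normSq2 (ψs n - ψ)) atTop (𝓝 0) →
      Tendsto (fun n => q (φs n)) atTop (𝓝 (q φ))

/-- The potential `W` vanishes at infinity with respect to `(P - A)²`. -/
def VanishesAtInfinity {d : ℕ} (A : E d → E d) (W : E d → ℝ) : Prop :=
  ∃ (R₀ : ℝ) (α γ : ℝ → ℝ), 0 < R₀ ∧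
    (∀ R, R₀ ≤ R → 0 < α R ∧ 0 < γ R) ∧
    Tendsto α atTop (𝓝 0) ∧ Tendsto γ atTop (𝓝 0) ∧
    (∀ φ ψ, IsMagneticDerivative A φ ψ → SuppOutside R₀ φ → InFormDomain W φ) ∧
    ∀ R, R₀ ≤ R → ∀ φ ψ, IsMagneticDerivative A φ ψ → SuppOutside R φ →
      |potentialForm W φ| ≤ α R * normSq2 ψ + γ R * normSq2 φ

/-- For all `R ≥ R₀` and all `φ ∈ 𝒟(P - A)` supported in `{|x| ≥ R}` one has
`q(φ) ≤ α_R ‖(P - A)φ‖² + γ_R ‖φ‖²`, for some positive `α_R → 0` and some positive `γ_R`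
which decrease to `c`. -/
def FormBoundAtInfinity {d : ℕ} (A : E d → E d) (q : (E d → ℂ) → ℝ) (R₀ c : ℝ) : Prop :=
  ∃ α γ : ℝ → ℝ,
    (∀ R, R₀ ≤ R → 0 < α R ∧ 0 < γ R) ∧
    Tendsto α atTop (𝓝 0) ∧
    AntitoneOn γ (Set.Ici R₀) ∧ Tendsto γ atTop (𝓝 c) ∧
    ∀ R, R₀ ≤ R → ∀ φ ψ, IsMagneticDerivative A φ ψ → SuppOutside R φ →
      q φ ≤ α R * normSq2 ψ + γ R * normSq2 φ

/-- All constants `c = lim γ_R` which occur in upper bounds at infinity on the potential `W` with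
respect to `(P - A)²`. -/
def upperBoundsAtInfinity {d : ℕ} (A : E d → E d) (W : E d → ℝ) : Set ℝ :=
  {c | ∃ R₀ : ℝ, 0 < R₀ ∧
    (∀ φ ψ, IsMagneticDerivative A φ ψ → SuppOutside R₀ φ → InFormDomain W φ) ∧
    FormBoundAtInfinity A (potentialForm W) R₀ c}

/-- `W` is bounded from above at infinity with respect to `(P - A)²`. -/
def BoundedAboveAtInfinity {d : ℕ} (A : E d → E d) (W : E d → ℝ) : Prop :=
  (upperBoundsAtInfinity A W).Nonempty

/-- `W` is bounded at infinity with respect to `(P - A)²`. -/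
def BoundedAtInfinity {d : ℕ} (A : E d → E d) (W : E d → ℝ) : Prop :=
  BoundedAboveAtInfinity A W ∧ BoundedAboveAtInfinity A (fun x => -W x)

/-- The asymptotic upper bound `γ⁺_∞(W)` of a potential `W` bounded from above at infinity. -/
def asymptoticUpperBound {d : ℕ} (A : E d → E d) (W : E d → ℝ) : ℝ :=
  sInf (upperBoundsAtInfinity A W)

/-- The asymptotic bound `γ_∞(W) = max (γ⁺_∞(W)) (γ⁺_∞(-W))` of a potential `W` bounded at
infinity. -/
def asymptoticBound {d : ℕ} (A : E d → E d) (W : E d → ℝ) : ℝ :=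
  max (asymptoticUpperBound A W) (asymptoticUpperBound A (fun x => -W x))

/-- All constants `c = lim γ_R` which occur in upper bounds at infinity on the distribution
`x · ∇V` with respect to `(P - A)²`. -/
def virialUpperBoundsAtInfinity {d : ℕ} (A : E d → E d) (V : E d → ℝ) : Set ℝ :=
  {c | ∃ (r R₀ : ℝ) (q : (E d → ℂ) → ℝ), 0 < r ∧ r < R₀ ∧ IsVirialFormOutside A V r q ∧
    FormBoundAtInfinity A q R₀ c}

/-- `x · ∇V` is bounded from above at infinity with respect to `(P - A)²`. -/
def VirialBoundedAboveAtInfinity {d : ℕ} (A : E d → E d) (V : E d → ℝ) : Prop :=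
  (virialUpperBoundsAtInfinity A V).Nonempty

/-- The asymptotic upper bound `γ⁺_∞(x · ∇V)`. -/
def virialAsymptoticUpperBound {d : ℕ} (A : E d → E d) (V : E d → ℝ) : ℝ :=
  sInf (virialUpperBoundsAtInfinity A V)

/-- Boundedness of the magnetic field and of the virial at infinity, with relative bounds
`β = lim β_j`, `ω₁ = lim ω_{1,j}`, `ω₂ = lim ω_{2,j}`. -/
def FieldAndVirialBoundedAtInfinity {d : ℕ} (A : E d → E d)
    (B : E d → Matrix (Fin d) (Fin d) ℝ) (V₁ V₂ : E d → ℝ) (β ω₁ ω₂ : ℝ) : Prop :=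
  ∃ (ε βs ω₁s ω₂s R : ℕ → ℝ) (r : ℝ) (q : (E d → ℂ) → ℝ),
    (∀ j, 0 < ε j ∧ 0 < βs j ∧ 0 < ω₁s j ∧ 0 < ω₂s j ∧ 0 < R j) ∧
    Tendsto ε atTop (𝓝 0) ∧ Tendsto R atTop atTop ∧
    Antitone βs ∧ Tendsto βs atTop (𝓝 β) ∧
    Antitone ω₁s ∧ Tendsto ω₁s atTop (𝓝 ω₁) ∧
    Antitone ω₂s ∧ Tendsto ω₂s atTop (𝓝 ω₂) ∧
    0 < r ∧ IsVirialFormOutside A V₂ r q ∧ (∀ j, r < R j) ∧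
    ∀ j φ ψ, IsMagneticDerivative A φ ψ → SuppOutside (R j) φ →
      (InFormDomain (fun x => ‖tildeB B x‖ ^ 2) φ ∧
        potentialForm (fun x => ‖tildeB B x‖ ^ 2) φ
          ≤ ε j * normSq2 ψ + βs j ^ 2 * normSq2 φ) ∧
      (InFormDomain (fun x => ‖V₁ x • x‖ ^ 2) φ ∧
        potentialForm (fun x => ‖V₁ x • x‖ ^ 2) φ
          ≤ ε j * normSq2 ψ + ω₁s j ^ 2 * normSq2 φ) ∧
      q φ ≤ ε j * normSq2 ψ + ω₂s j * normSq2 φ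

/-- `f` is (essentially) bounded outside of a compact set. -/
def BoundedOutsideCompact {d : ℕ} {F : Type*} [NormedAddCommGroup F] (f : E d → F) : Prop :=
  ∃ K : Set (E d), IsCompact K ∧ ∃ C : ℝ, ∀ᵐ x : E d, x ∉ K → ‖f x‖ ≤ C

/-- The filter of neighbourhoods of infinity in `ℝ^d`, up to null sets. -/
def essAtInfinity (d : ℕ) : Filter (E d) :=
  ae (volume : Measure (E d)) ⊓ Bornology.cobounded (E d)

/-- The essential `limsup_{|x| → ∞} f(x) = lim_{R → ∞} ess sup_{|x| ≥ R} f(x)` (for functions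
which are essentially bounded outside of a compact set). -/
def essLimsupAtInfinity {d : ℕ} (f : E d → ℝ) : ℝ :=
  limsup f (essAtInfinity d)

/-- Outside of a compact set the distribution `x · ∇V` is the locally integrable function `W`:
`∫ W η = -∫ V ∇·(x η)` for all test functions `η` supported there. -/
def IsVirialOutsideCompact {d : ℕ} (V W : E d → ℝ) : Prop :=
  ∃ K : Set (E d), IsCompact K ∧ LocallyIntegrableOn W Kᶜ volume ∧
    ∀ η : E d → ℝ, ContDiff ℝ ∞ η → HasCompactSupport η → tsupport η ⊆ Kᶜ →
      ∫ x, W x * η x = -∫ x, V x * ((d : ℝ) * η x + fderiv ℝ η x x)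

end MagneticForms

end

open MagneticForms

namespace MagneticForms

/-! Every potential involved is essentially bounded outside a ball, so for `φ` in `L²` supported in
`|x| ≥ R` the form `⟨φ, f φ⟩` is at most the essential supremum of `f` over `|x| ≥ R` times `‖φ‖²`.
The kinetic energy is never needed: the coefficients `α_R = 1/R` and `ε_j = 1/(j+1)` only meet the
demand for positive coefficients. What remains is to turn a limsup into a positive decreasing family
`γ_R` with the right limit (`EssLeAtInfinity.exists_antitone_bound`).

The virial form needs one more idea. Testing `x · ∇V₂ = W` with the density `|φ|²` gives exactly the
form of `W` (`potentialForm_eq_virialForm`). As `W` is bounded far out, its form is continuous in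
`L²` (`tendsto_potentialForm`), hence in the graph norm, and so it is the required extension. -/

variable {d : ℕ}

/-! ### Essential bounds at infinity -/

/-- Eventual statements near infinity hold almost everywhere outside of a ball. -/
lemma eventually_essAtInfinity_iff {p : E d → Prop} :
    (∀ᶠ x in essAtInfinity d, p x) ↔ ∃ R : ℝ, ∀ᵐ x : E d, R ≤ ‖x‖ → p x := by
  rw [essAtInfinity, Filter.eventually_inf]
  constructor
  · rintro ⟨s, hs, t, ht, hst⟩
    obtain ⟨R, -, hR⟩ := (hasBasis_cobounded_norm (E := E d)).mem_iff.1 ht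
    exact ⟨R, Filter.Eventually.mono hs fun x hx hxR => hst x ⟨hx, hR hxR⟩⟩
  · rintro ⟨R, hR⟩
    exact ⟨_, hR, _, hasBasis_cobounded_norm.mem_of_mem (i := R) trivial, fun x hx => hx.1 hx.2⟩

lemma ae_outside_mono {p : E d → Prop} {R R' : ℝ} (h : R ≤ R')
    (hp : ∀ᵐ x : E d, R ≤ ‖x‖ → p x) : ∀ᵐ x : E d, R' ≤ ‖x‖ → p x :=
  hp.mono fun _ hx hR => hx (h.trans hR)

lemma exists_ball_superset {K : Set (E d)} (hK : IsCompact K) :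
    ∃ r : ℝ, 0 < r ∧ ∀ x : E d, r ≤ ‖x‖ → x ∉ K := by
  obtain ⟨r, hr, h⟩ := hK.isBounded.exists_pos_norm_lt
  exact ⟨r, hr, fun x hx hxK => absurd (h x hxK) (not_lt.2 hx)⟩

lemma BoundedOutsideCompact.exists_bound {F : Type*} [NormedAddCommGroup F] {f : E d → F}
    (hf : BoundedOutsideCompact f) :
    ∃ R C : ℝ, 0 < R ∧ ∀ᵐ x : E d, R ≤ ‖x‖ → ‖f x‖ ≤ C := by
  obtain ⟨K, hK, C, hC⟩ := hf
  obtain ⟨R, hR, h⟩ := exists_ball_superset hK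
  exact ⟨R, C, hR, hC.mono fun x hx hxR => hx (h x hxR)⟩

/-- `c` is an upper bound of `f` at infinity up to arbitrarily small errors. -/
def EssLeAtInfinity (f : E d → ℝ) (c : ℝ) : Prop :=
  ∀ ε : ℝ, 0 < ε → ∃ R : ℝ, ∀ᵐ x : E d, R ≤ ‖x‖ → f x ≤ c + ε

lemma essLimsupAtInfinity_nonneg {f : E d → ℝ} (hf : ∀ x, 0 ≤ f x) :
    0 ≤ essLimsupAtInfinity f := by
  rw [essLimsupAtInfinity, limsup_eq]
  -- For a trivial filter every real is an eventual bound, and `sInf` of all of `ℝ` is 0 by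
  -- convention.
  rcases (essAtInfinity d).eq_or_neBot with h | h
  · simp [h]
  · refine Real.sInf_nonneg fun a ha => ?_
    obtain ⟨x, hx⟩ := (show ∀ᶠ x in essAtInfinity d, f x ≤ a from ha).exists
    exact (hf x).trans hx

/-- The bound `C` makes the set of eventual bounds nonempty; without it the real `limsup` would be a
default value. -/
lemma essLeAtInfinity_essLimsup {f : E d → ℝ} {R C : ℝ}
    (hf : ∀ᵐ x : E d, R ≤ ‖x‖ → f x ≤ C) : EssLeAtInfinity f (essLimsupAtInfinity f) := by
  intro ε hε
  rw [← eventually_essAtInfinity_iff]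
  have hb : IsBoundedUnder (· ≤ ·) (essAtInfinity d) f :=
    ⟨C, by simpa using eventually_essAtInfinity_iff.2 ⟨R, hf⟩⟩
  exact (eventually_lt_of_limsup_lt (b := essLimsupAtInfinity f + ε)
    (by rw [essLimsupAtInfinity]; linarith) hb).mono fun _ h => h.le

lemma EssLeAtInfinity.sq {f : E d → ℝ} {c : ℝ} (hf : ∀ x, 0 ≤ f x)
    (h : EssLeAtInfinity f c) : EssLeAtInfinity (fun x => f x ^ 2) (c ^ 2) := by
  intro ε hε
  -- The gap `√(c² + ε) - c` is the error allowed for `f` itself; it is positive for either sign of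
  -- `c`.
  have hlt : c < Real.sqrt (c ^ 2 + ε) := Real.lt_sqrt_of_sq_lt (by linarith)
  obtain ⟨R, hR⟩ := h _ (sub_pos.2 hlt)
  refine ⟨R, hR.mono fun x hx hxR => ?_⟩
  have h1 : f x ≤ Real.sqrt (c ^ 2 + ε) := by linarith [hx hxR]
  calc f x ^ 2 ≤ Real.sqrt (c ^ 2 + ε) ^ 2 := pow_le_pow_left₀ (hf x) h1 2
    _ = c ^ 2 + ε := Real.sq_sqrt (by positivity)

lemma essLeAtInfinity_abs_of_tendsto {f : E d → ℝ}
    (hf : Tendsto f (essAtInfinity d) (𝓝 0)) : EssLeAtInfinity (fun x => |f x|) 0 := by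
  intro ε hε
  rw [← eventually_essAtInfinity_iff]
  filter_upwards [hf.eventually (Metric.ball_mem_nhds 0 hε)] with x hx
  simpa using (mem_ball_zero_iff.1 hx).le

/-- An eventual upper bound can be approached by a decreasing family of bounds outside balls. -/
lemma EssLeAtInfinity.exists_antitone_bound {f : E d → ℝ} {c R₀ C : ℝ} (hR₀ : 0 < R₀)
    (hc : 0 ≤ c) (hC : ∀ᵐ x : E d, R₀ ≤ ‖x‖ → f x ≤ C) (h : EssLeAtInfinity f c) :
    ∃ γ : ℝ → ℝ, (∀ R, R₀ ≤ R → 0 < γ R) ∧ AntitoneOn γ (Set.Ici R₀) ∧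
      Tendsto γ atTop (𝓝 c) ∧ ∀ R, R₀ ≤ R → ∀ᵐ x : E d, R ≤ ‖x‖ → f x ≤ γ R := by
  -- Essential upper bounds cut off at `c`: the infimum then tends to `c` itself, even when `f`
  -- stays well below `c`.
  set S : ℝ → Set ℝ := fun R => {a | c ≤ a ∧ ∀ᵐ x : E d, R ≤ ‖x‖ → f x ≤ a} with hS
  have hbdd : ∀ R, BddBelow (S R) := fun R => ⟨c, fun a ha => ha.1⟩
  have hne : ∀ R, R₀ ≤ R → (S R).Nonempty := fun R hR =>
    ⟨max c C, le_max_left _ _, (ae_outside_mono hR hC).mono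
      fun x hx hxR => (hx hxR).trans (le_max_right _ _)⟩
  have hle : ∀ R, R₀ ≤ R → c ≤ sInf (S R) := fun R hR => le_csInf (hne R hR) fun a ha => ha.1
  have hinv : Tendsto (fun R : ℝ => R⁻¹) atTop (𝓝 0) := tendsto_inv_atTop_zero
  have hlim : Tendsto (fun R => sInf (S R)) atTop (𝓝 c) := by
    refine tendsto_order.2 ⟨fun a ha => ?_, fun a ha => ?_⟩
    · filter_upwards [eventually_ge_atTop R₀] with R hR
      exact ha.trans_le (hle R hR)
    · obtain ⟨R₁, hR₁⟩ := h ((a - c) / 2) (by linarith)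
      filter_upwards [eventually_ge_atTop R₁] with R hR
      have : c + (a - c) / 2 ∈ S R := ⟨by linarith, ae_outside_mono hR hR₁⟩
      linarith [csInf_le (hbdd R) this]
  -- The term `R⁻¹` gives positivity when `c = 0`, and leaves room for an element of `S R` below `γ
  -- R`, so the infimum need not be attained.
  refine ⟨fun R => sInf (S R) + R⁻¹, fun R hR => ?_, fun R hR R' hR' hRR' => ?_, ?_,
    fun R hR => ?_⟩
  · have : 0 < R⁻¹ := inv_pos.2 (hR₀.trans_le hR)
    linarith [hle R hR]
  · refine add_le_add (csInf_le_csInf (hbdd R') (hne R hR) fun a ha =>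
      ⟨ha.1, ae_outside_mono hRR' ha.2⟩) ?_
    exact inv_anti₀ (hR₀.trans_le hR) hRR'
  · simpa using hlim.add hinv
  · have : 0 < R⁻¹ := inv_pos.2 (hR₀.trans_le hR)
    obtain ⟨a, ha, hlt⟩ := exists_lt_of_csInf_lt (hne R hR) (lt_add_of_pos_right _ this)
    exact ha.2.mono fun x hx hxR => (hx hxR).trans hlt.le

/-! ### Quadratic forms of bounded potentials -/

lemma normSq2_nonneg {F : Type*} [NormedAddCommGroup F] (φ : E d → F) : 0 ≤ normSq2 φ :=
  integral_nonneg fun _ => by positivity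

lemma SuppOutside.mono {R R' : ℝ} {φ : E d → ℂ} (h : R ≤ R') (hφ : SuppOutside R' φ) :
    SuppOutside R φ :=
  Filter.Eventually.mono hφ fun _ hx hxR => hx (hxR.trans_le h)

lemma integrable_norm_sq {φ : E d → ℂ} (hφ : MemLp φ 2 volume) :
    Integrable (fun x => ‖φ x‖ ^ 2) volume :=
  (memLp_two_iff_integrable_sq_norm hφ.1).1 hφ

lemma measurableSet_outside (R : ℝ) : MeasurableSet {x : E d | R ≤ ‖x‖} :=
  measurableSet_le measurable_const measurable_norm

/-- A potential which is bounded outside of a ball has all square integrable functions supported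
there in its form domain. -/
lemma inFormDomain_of_bounded {f : E d → ℝ} {R C : ℝ}
    (hm : AEStronglyMeasurable f (volume.restrict {x : E d | R ≤ ‖x‖}))
    (hC : ∀ᵐ x : E d, R ≤ ‖x‖ → |f x| ≤ C) {φ : E d → ℂ} (hφ : MemLp φ 2 volume)
    (hs : SuppOutside R φ) : InFormDomain f φ := by
  have h1 : IntegrableOn (fun x => f x * ‖φ x‖ ^ 2) {x : E d | R ≤ ‖x‖} volume := by
    refine (integrable_norm_sq hφ).integrableOn.bdd_mul (c := C) hm ?_
    exact (ae_restrict_iff' (measurableSet_outside R)).2 (by simpa using hC)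
  refine h1.integrable_of_ae_notMem_eq_zero ?_
  filter_upwards [hs] with x hx hxR
  simp [hx (by simpa using hxR)]

lemma potentialForm_le {f : E d → ℝ} {R c : ℝ} (hc : ∀ᵐ x : E d, R ≤ ‖x‖ → f x ≤ c)
    {φ : E d → ℂ} (hφ : MemLp φ 2 volume) (hs : SuppOutside R φ) (hd : InFormDomain f φ) :
    potentialForm f φ ≤ c * normSq2 φ := by
  rw [potentialForm, normSq2, ← integral_const_mul]
  refine integral_mono_ae hd ((integrable_norm_sq hφ).const_mul c) ?_
  filter_upwards [hc, hs] with x hx hsx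
  rcases lt_or_ge ‖x‖ R with h | h
  · simp [hsx h]
  · exact mul_le_mul_of_nonneg_right (hx h) (by positivity)

lemma abs_potentialForm_le {f : E d → ℝ} {R c : ℝ} (hc : ∀ᵐ x : E d, R ≤ ‖x‖ → |f x| ≤ c)
    {φ : E d → ℂ} (hφ : MemLp φ 2 volume) (hs : SuppOutside R φ) (hd : InFormDomain f φ) :
    |potentialForm f φ| ≤ c * normSq2 φ := by
  have hneg : potentialForm (fun x => -f x) φ = -potentialForm f φ := by
    simp [potentialForm, integral_neg]
  refine abs_le'.2 ⟨potentialForm_le (hc.mono fun x hx h => (le_abs_self _).trans (hx h)) hφ hs hd,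
    ?_⟩
  rw [← hneg]
  refine potentialForm_le (hc.mono fun x hx h => (neg_le_abs _).trans (hx h)) hφ hs ?_
  simpa [InFormDomain] using Integrable.neg hd

lemma formBoundAtInfinity_potentialForm (A : E d → E d) {f : E d → ℝ} {c R₀ C : ℝ}
    (hR₀ : 0 < R₀) (hc : 0 ≤ c) (hm : AEStronglyMeasurable f (volume.restrict {x : E d | R₀ ≤ ‖x‖}))
    (hC : ∀ᵐ x : E d, R₀ ≤ ‖x‖ → |f x| ≤ C) (h : EssLeAtInfinity f c) :
    FormBoundAtInfinity A (potentialForm f) R₀ c := by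
  obtain ⟨γ, hpos, hanti, hlim, hb⟩ := h.exists_antitone_bound hR₀ hc
    (hC.mono fun x hx hxR => (le_abs_self _).trans (hx hxR))
  refine ⟨fun R => R⁻¹, γ, fun R hR => ⟨inv_pos.2 (hR₀.trans_le hR), hpos R hR⟩,
    tendsto_inv_atTop_zero, hanti, hlim, fun R hR φ ψ hφ hs => ?_⟩
  have h1 := potentialForm_le (hb R hR) hφ.memLp hs
    (inFormDomain_of_bounded hm hC hφ.memLp (hs.mono hR))
  have h2 : 0 ≤ R⁻¹ * normSq2 ψ :=
    mul_nonneg (inv_nonneg.2 (hR₀.trans_le hR).le) (normSq2_nonneg ψ)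
  linarith

lemma mem_upperBoundsAtInfinity (A : E d → E d) {f : E d → ℝ} {c R₀ C : ℝ}
    (hR₀ : 0 < R₀) (hc : 0 ≤ c) (hm : AEStronglyMeasurable f volume)
    (hC : ∀ᵐ x : E d, R₀ ≤ ‖x‖ → |f x| ≤ C) (h : EssLeAtInfinity f c) :
    c ∈ upperBoundsAtInfinity A f :=
  ⟨R₀, hR₀, fun _ _ hφ hs => inFormDomain_of_bounded hm.restrict hC hφ.memLp hs,
    formBoundAtInfinity_potentialForm A hR₀ hc hm.restrict hC h⟩

/-- A limit of positive `γ_R` is nonnegative. Thus the sets defining the asymptotic bounds are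
bounded below, and their infimum lies below each member. -/
lemma FormBoundAtInfinity.nonneg {A : E d → E d} {q : (E d → ℂ) → ℝ} {R₀ c : ℝ}
    (h : FormBoundAtInfinity A q R₀ c) : 0 ≤ c := by
  obtain ⟨α, γ, hpos, -, -, hlim, -⟩ := h
  refine ge_of_tendsto hlim ?_
  filter_upwards [eventually_ge_atTop R₀] with R hR using (hpos R hR).2.le

lemma asymptoticUpperBound_le {A : E d → E d} {f : E d → ℝ} {c : ℝ}
    (h : c ∈ upperBoundsAtInfinity A f) : asymptoticUpperBound A f ≤ c :=
  csInf_le ⟨0, fun _ ⟨_, _, _, hb⟩ => hb.nonneg⟩ h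

lemma vanishesAtInfinity_of_tendsto (A : E d → E d) {f : E d → ℝ}
    (hm : AEStronglyMeasurable f volume) (hb : BoundedOutsideCompact f)
    (hlim : Tendsto f (essAtInfinity d) (𝓝 0)) : VanishesAtInfinity A f := by
  obtain ⟨R₀, C, hR₀, hC⟩ := hb.exists_bound
  obtain ⟨γ, hpos, -, hγ, hbd⟩ :=
    (essLeAtInfinity_abs_of_tendsto hlim).exists_antitone_bound hR₀ le_rfl hC
  have hdom : ∀ φ ψ, IsMagneticDerivative A φ ψ → SuppOutside R₀ φ → InFormDomain f φ :=
    fun φ ψ hφ hs => inFormDomain_of_bounded hm.restrict hC hφ.memLp hs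
  refine ⟨R₀, fun R => R⁻¹, γ, hR₀, fun R hR => ⟨inv_pos.2 (hR₀.trans_le hR), hpos R hR⟩,
    tendsto_inv_atTop_zero, hγ, hdom, fun R hR φ ψ hφ hs => ?_⟩
  have h1 := abs_potentialForm_le (hbd R hR) hφ.memLp hs (hdom φ ψ hφ (hs.mono hR))
  have h2 : 0 ≤ R⁻¹ * normSq2 ψ :=
    mul_nonneg (inv_nonneg.2 (hR₀.trans_le hR).le) (normSq2_nonneg ψ)
  linarith

/-- The square of a field which is bounded at infinity is bounded at infinity as a potential, and
its asymptotic bound is controlled by the essential `limsup` of the field. -/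
lemma boundedAtInfinity_norm_sq (A : E d → E d) {F : E d → E d}
    (hm : AEStronglyMeasurable F volume) {R C : ℝ} (hR : 0 < R)
    (hC : ∀ᵐ x : E d, R ≤ ‖x‖ → ‖F x‖ ≤ C) :
    BoundedAtInfinity A (fun x => ‖F x‖ ^ 2) ∧
      Real.sqrt (asymptoticBound A (fun x => ‖F x‖ ^ 2))
        ≤ essLimsupAtInfinity (fun x => ‖F x‖) := by
  have h0 : 0 ≤ essLimsupAtInfinity (fun x => ‖F x‖) :=
    essLimsupAtInfinity_nonneg fun x => norm_nonneg _
  have hm2 : AEStronglyMeasurable (fun x => ‖F x‖ ^ 2) volume := hm.norm.pow 2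
  have hC2 : ∀ᵐ x : E d, R ≤ ‖x‖ → |‖F x‖ ^ 2| ≤ C ^ 2 := hC.mono fun x hx hxR => by
    rw [abs_of_nonneg (by positivity)]
    exact pow_le_pow_left₀ (norm_nonneg _) (hx hxR) 2
  have hup := mem_upperBoundsAtInfinity A hR (sq_nonneg _) hm2 hC2
    ((essLeAtInfinity_essLimsup hC).sq (fun x => norm_nonneg _))
  -- Since `-|F|² ≤ 0`, the lower side of the two-sided bound costs nothing.
  have hlow : (0 : ℝ) ∈ upperBoundsAtInfinity A (fun x => -‖F x‖ ^ 2) :=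
    mem_upperBoundsAtInfinity A hR le_rfl hm2.neg (by simpa using hC2) fun ε hε =>
      ⟨0, ae_of_all _ fun x _ => by nlinarith [sq_nonneg ‖F x‖]⟩
  refine ⟨⟨⟨_, hup⟩, ⟨_, hlow⟩⟩, Real.sqrt_le_iff.2 ⟨h0, max_le (asymptoticUpperBound_le hup) ?_⟩⟩
  exact (asymptoticUpperBound_le hlow).trans (sq_nonneg _)

/-! ### Continuity of the form in `L²` -/

/-- Young's inequality applied to the cross term of `|a|² - |b|² = (|a| - |b|)² + 2(|a| - |b|)|b|`.
The free `δ` replaces an integral Cauchy–Schwarz inequality. -/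
lemma abs_norm_sq_sub_le (a b : ℂ) {δ : ℝ} (hδ : 0 < δ) :
    |‖a‖ ^ 2 - ‖b‖ ^ 2| ≤ (1 + δ⁻¹) * ‖a - b‖ ^ 2 + δ * ‖b‖ ^ 2 := by
  have h1 : |‖a‖ - ‖b‖| ≤ ‖a - b‖ := abs_norm_sub_norm_le a b
  have h2 : ‖a‖ ^ 2 - ‖b‖ ^ 2 = (‖a‖ - ‖b‖) ^ 2 + 2 * (‖a‖ - ‖b‖) * ‖b‖ := by ring
  have h3 : 2 * ‖a - b‖ * ‖b‖ ≤ δ⁻¹ * ‖a - b‖ ^ 2 + δ * ‖b‖ ^ 2 := by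
    have h : 0 ≤ δ⁻¹ * (‖a - b‖ - δ * ‖b‖) ^ 2 := by positivity
    have h' : δ⁻¹ * (‖a - b‖ - δ * ‖b‖) ^ 2
        = δ⁻¹ * ‖a - b‖ ^ 2 + δ * ‖b‖ ^ 2 - 2 * ‖a - b‖ * ‖b‖ := by
      field_simp
      ring
    linarith
  have h4 : (‖a‖ - ‖b‖) ^ 2 ≤ ‖a - b‖ ^ 2 := sq_le_sq' (by linarith [abs_le.1 h1]) (abs_le.1 h1).2
  calc |‖a‖ ^ 2 - ‖b‖ ^ 2| ≤ (‖a‖ - ‖b‖) ^ 2 + 2 * |‖a‖ - ‖b‖| * ‖b‖ := by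
        rw [h2]
        refine (abs_add_le _ _).trans (le_of_eq ?_)
        rw [abs_mul, abs_mul, abs_of_nonneg (sq_nonneg _), abs_of_nonneg (norm_nonneg b),
          abs_of_pos (two_pos : (0 : ℝ) < 2)]
    _ ≤ ‖a - b‖ ^ 2 + 2 * ‖a - b‖ * ‖b‖ := by gcongr
    _ ≤ (1 + δ⁻¹) * ‖a - b‖ ^ 2 + δ * ‖b‖ ^ 2 := by linarith

lemma abs_potentialForm_sub_le {f : E d → ℝ} {R C : ℝ}
    (hm : AEStronglyMeasurable f (volume.restrict {x : E d | R ≤ ‖x‖})) (hC0 : 0 ≤ C)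
    (hC : ∀ᵐ x : E d, R ≤ ‖x‖ → |f x| ≤ C) {φ χ : E d → ℂ} (hφ : MemLp φ 2 volume)
    (hχ : MemLp χ 2 volume) (hφs : SuppOutside R φ) (hχs : SuppOutside R χ) {δ : ℝ} (hδ : 0 < δ) :
    |potentialForm f χ - potentialForm f φ| ≤
      C * ((1 + δ⁻¹) * normSq2 (χ - φ) + δ * normSq2 φ) := by
  have hi : Integrable (fun x => (1 + δ⁻¹) * ‖(χ - φ) x‖ ^ 2) volume :=
    (integrable_norm_sq (hχ.sub hφ)).const_mul _
  have hi' : Integrable (fun x => δ * ‖φ x‖ ^ 2) volume := (integrable_norm_sq hφ).const_mul _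
  rw [potentialForm, potentialForm,
    ← integral_sub (inFormDomain_of_bounded hm hC hχ hχs) (inFormDomain_of_bounded hm hC hφ hφs),
    normSq2, normSq2, ← integral_const_mul, ← integral_const_mul, ← integral_add hi hi',
    ← integral_const_mul, ← Real.norm_eq_abs]
  refine norm_integral_le_of_norm_le ((hi.add hi').const_mul C) ?_
  filter_upwards [hC, hφs, hχs] with x hx h1 h2
  rcases lt_or_ge ‖x‖ R with h | h
  · simp [h1 h, h2 h]
  · rw [← mul_sub, norm_mul, Real.norm_eq_abs, Real.norm_eq_abs]
    exact mul_le_mul (hx h) (abs_norm_sq_sub_le _ _ hδ) (abs_nonneg _) hC0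

lemma tendsto_potentialForm {f : E d → ℝ} {R C : ℝ}
    (hm : AEStronglyMeasurable f (volume.restrict {x : E d | R ≤ ‖x‖}))
    (hC : ∀ᵐ x : E d, R ≤ ‖x‖ → |f x| ≤ C) {φ : E d → ℂ} {φs : ℕ → E d → ℂ}
    (hφ : MemLp φ 2 volume) (hφs : ∀ n, MemLp (φs n) 2 volume) (hs : SuppOutside R φ)
    (hss : ∀ n, SuppOutside R (φs n))
    (hlim : Tendsto (fun n => normSq2 (φs n - φ)) atTop (𝓝 0)) :
    Tendsto (fun n => potentialForm f (φs n)) atTop (𝓝 (potentialForm f φ)) := by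
  set D := max C 0
  have hD : ∀ᵐ x : E d, R ≤ ‖x‖ → |f x| ≤ D :=
    hC.mono fun x hx hxR => (hx hxR).trans (le_max_left _ _)
  have hsq : Tendsto (fun n => Real.sqrt (normSq2 (φs n - φ))) atTop (𝓝 0) := by
    simpa using hlim.sqrt
  -- The choice `δ = ‖φₙ - φ‖ + 1/(n+1)` tends to 0, while `δ⁻¹ ‖φₙ - φ‖² ≤ ‖φₙ - φ‖`; the second
  -- summand keeps `δ` positive when the norm vanishes.
  have hδ := hsq.add tendsto_one_div_add_atTop_nhds_zero_nat
  have hmaj : Tendsto (fun n : ℕ => D * (normSq2 (φs n - φ) + Real.sqrt (normSq2 (φs n - φ))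
      + (Real.sqrt (normSq2 (φs n - φ)) + 1 / ((n : ℝ) + 1)) * normSq2 φ)) atTop (𝓝 0) := by
    simpa using ((hlim.add hsq).add (hδ.mul_const (normSq2 φ))).const_mul D
  rw [tendsto_iff_dist_tendsto_zero]
  refine squeeze_zero (fun _ => dist_nonneg) (fun n => ?_) hmaj
  set s := Real.sqrt (normSq2 (φs n - φ)) with hs_def
  have hs0 : 0 ≤ s := Real.sqrt_nonneg _
  have hss2 : normSq2 (φs n - φ) = s ^ 2 := (Real.sq_sqrt (normSq2_nonneg _)).symm
  have hn : 0 < 1 / ((n : ℝ) + 1) := by positivity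
  have hδ0 : 0 < s + 1 / ((n : ℝ) + 1) := by linarith
  refine (abs_potentialForm_sub_le hm (le_max_right C 0) hD hφ (hφs n) hs (hss n) hδ0).trans ?_
  refine mul_le_mul_of_nonneg_left ?_ (le_max_right C 0)
  have h1 : (s + 1 / ((n : ℝ) + 1))⁻¹ * s ^ 2 ≤ s := by
    rw [inv_mul_le_iff₀ hδ0]
    nlinarith
  rw [hss2]
  linarith

/-! ### The virial form as the form of `W` -/

lemma fderiv_norm_sq_apply {φ : E d → ℂ} {x : E d} (hφ : DifferentiableAt ℝ φ x) (v : E d) :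
    fderiv ℝ (fun y => ‖φ y‖ ^ 2) x v = 2 * ((starRingEnd ℂ) (φ x) * fderiv ℝ φ x v).re := by
  rw [hφ.hasFDerivAt.norm_sq.fderiv]
  simp [Complex.inner, mul_comm]
  ring

/-- On test functions supported where `x · ∇V = W` the virial form is the form of `W`. -/
lemma potentialForm_eq_virialForm {V W : E d → ℝ} (hV : LocallyIntegrable V volume) {U : Set (E d)}
    (hW : ∀ η : E d → ℝ, ContDiff ℝ ∞ η → HasCompactSupport η → tsupport η ⊆ U →
      ∫ x, W x * η x = -∫ x, V x * ((d : ℝ) * η x + fderiv ℝ η x x))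
    {φ : E d → ℂ} (hφ : IsTestFunction φ) (hs : tsupport φ ⊆ U) :
    potentialForm W φ = virialForm V φ := by
  obtain ⟨hsm, hcs⟩ := hφ
  -- The density `|φ|²` is a smooth real test function with `x · ∇|φ|² = 2 Re (φ̄ x · ∇φ)`, the
  -- second term of the virial form.
  set η : E d → ℝ := fun x => ‖φ x‖ ^ 2 with hη
  have hηsm : ContDiff ℝ ∞ η := hsm.norm_sq ℝ
  have hsub : Function.support η ⊆ Function.support φ := fun x hx hx' => hx (by simp [hη, hx'])
  have hηcs : HasCompactSupport η := hcs.mono hsub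
  have hφd : Continuous fun x => fderiv ℝ φ x x :=
    (hsm.continuous_fderiv (by simp)).clm_apply continuous_id
  have hg : Continuous fun x => (starRingEnd ℂ) (φ x) * fderiv ℝ φ x x :=
    (Complex.continuous_conj.comp hsm.continuous).mul hφd
  have hgc : HasCompactSupport fun x => (starRingEnd ℂ) (φ x) * fderiv ℝ φ x x :=
    hcs.mono fun x hx hx' => hx (by simp [hx'])
  have hgi : Integrable (fun x => V x • ((starRingEnd ℂ) (φ x) * fderiv ℝ φ x x)) volume :=
    hV.integrable_smul_right_of_hasCompactSupport hg hgc
  have hηi : Integrable (fun x => V x * η x) volume :=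
    hV.integrable_smul_right_of_hasCompactSupport hηsm.continuous hηcs
  have hgre : Integrable (fun x => V x * ((starRingEnd ℂ) (φ x) * fderiv ℝ φ x x).re) volume := by
    simpa using hgi.re
  have hre : (∫ x, (starRingEnd ℂ) ((V x : ℂ) * φ x) * fderiv ℝ φ x x).re
      = ∫ x, V x * ((starRingEnd ℂ) (φ x) * fderiv ℝ φ x x).re := by
    have h1 : (fun x => (starRingEnd ℂ) ((V x : ℂ) * φ x) * fderiv ℝ φ x x)
        = fun x => V x • ((starRingEnd ℂ) (φ x) * fderiv ℝ φ x x) := by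
      funext x
      rw [map_mul, Complex.conj_ofReal, Complex.real_smul, mul_assoc]
    rw [h1]
    have h2 := integral_re hgi
    simpa using h2.symm
  have hkey := hW η hηsm hηcs ((closure_mono hsub).trans hs)
  rw [virialForm, hre]
  change ∫ x, W x * η x = -(d : ℝ) * (∫ x, V x * η x) - _
  have h3 : (fun x => V x * ((d : ℝ) * η x + fderiv ℝ η x x)) = fun x =>
      (d : ℝ) * (V x * η x) + 2 * (V x * ((starRingEnd ℂ) (φ x) * fderiv ℝ φ x x).re) := by
    funext x
    rw [fderiv_norm_sq_apply (hsm.contDiffAt.differentiableAt (by simp))]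
    ring
  rw [hkey, h3, integral_add (hηi.const_mul _) (hgre.const_mul _), integral_const_mul,
    integral_const_mul]
  ring

/-- A bounded function representing `x · ∇V` outside of a compact set gives the extension of the
virial form. -/
lemma isVirialFormOutside_potentialForm (A : E d → E d) {V W : E d → ℝ}
    (hV : LocallyIntegrable V volume) (hW : IsVirialOutsideCompact V W)
    (hb : BoundedOutsideCompact W) :
    ∃ r C : ℝ, 0 < r ∧ AEStronglyMeasurable W (volume.restrict {x : E d | r ≤ ‖x‖}) ∧
      (∀ᵐ x : E d, r ≤ ‖x‖ → |W x| ≤ C) ∧ IsVirialFormOutside A V r (potentialForm W) := by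
  obtain ⟨K, hK, hint, hWK⟩ := hW
  obtain ⟨r₁, hr₁, hK₁⟩ := exists_ball_superset hK
  obtain ⟨r₂, C, hr₂, hC⟩ := hb.exists_bound
  -- `W` is controlled only off `K`, so its measurability is available only for the restricted
  -- measure.
  have hm : AEStronglyMeasurable W (volume.restrict {x : E d | max r₁ r₂ ≤ ‖x‖}) :=
    hint.aestronglyMeasurable.mono_measure
      (Measure.restrict_mono (fun x hx => hK₁ x ((le_max_left _ _).trans hx)) le_rfl)
  have hC' : ∀ᵐ x : E d, max r₁ r₂ ≤ ‖x‖ → |W x| ≤ C := ae_outside_mono (le_max_right _ _) hC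
  refine ⟨max r₁ r₂, C, lt_max_of_lt_left hr₁, hm, hC', fun φ hφ hs => ?_,
    fun R hR φ ψ φs ψs hφ hs hφs hlim _ => ?_⟩
  · exact potentialForm_eq_virialForm hV hWK hφ
      (hs.trans fun x hx => hK₁ x ((le_max_left _ _).trans (le_of_lt hx)))
  -- Continuity in `L²` implies continuity in the stronger graph norm.
  · exact tendsto_potentialForm hm hC' hφ.memLp (fun n => (hφs n).1.memLp) (hs.mono hR.le)
      (fun n => (hφs n).2.mono hR.le) hlim

/-! ### Sequences of relative bounds -/

lemma EssLeAtInfinity.of_max_zero {f : E d → ℝ} {c : ℝ}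
    (h : EssLeAtInfinity (fun x => max (f x) 0) c) : EssLeAtInfinity f c := fun ε hε =>
  (h ε hε).imp fun _ hR => hR.mono fun _ hx hxR => (le_max_left _ _).trans (hx hxR)

lemma aestronglyMeasurable_tildeB {B : E d → Matrix (Fin d) (Fin d) ℝ}
    (hB : ∀ i j, AEStronglyMeasurable (fun x => B x i j) volume) :
    AEStronglyMeasurable (tildeB B) volume := by
  have h : AEStronglyMeasurable (fun x : E d => fun j => ∑ m, B x j m * x m) volume := by
    refine (aemeasurable_pi_lambda _ fun j => ?_).aestronglyMeasurable
    exact Finset.aemeasurable_fun_sum _ fun m _ => (hB j m).aemeasurable.mul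
      (by fun_prop : Measurable fun x : E d => x m).aemeasurable
  exact (PiLp.continuous_toLp 2 _).comp_aestronglyMeasurable h

/-- Essential upper bounds at infinity on `|B̃|`, `|x V₁|` and `x · ∇V₂ = W` are relative bounds
at infinity. -/
lemma fieldAndVirialBoundedAtInfinity (A : E d → E d) {B : E d → Matrix (Fin d) (Fin d) ℝ}
    {V₁ V₂ W : E d → ℝ} {β ω₁ ω₂ r C : ℝ} (hβ : 0 ≤ β) (hω₁ : 0 ≤ ω₁) (hω₂ : 0 ≤ ω₂)
    (hBm : AEStronglyMeasurable (tildeB B) volume)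
    (hVm : AEStronglyMeasurable (fun x => V₁ x • x) volume) (hr : 0 < r)
    (hWm : AEStronglyMeasurable W (volume.restrict {x : E d | r ≤ ‖x‖}))
    (hWC : ∀ᵐ x : E d, r ≤ ‖x‖ → |W x| ≤ C)
    (hq : IsVirialFormOutside A V₂ r (potentialForm W))
    (hB : EssLeAtInfinity (fun x => ‖tildeB B x‖) β)
    (hV : EssLeAtInfinity (fun x => ‖V₁ x • x‖) ω₁) (hW : EssLeAtInfinity W ω₂) :
    FieldAndVirialBoundedAtInfinity A B V₁ V₂ β ω₁ ω₂ := by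
  have hpos : ∀ j : ℕ, 0 < 1 / ((j : ℝ) + 1) := fun j => by positivity
  have hlim : Tendsto (fun j : ℕ => 1 / ((j : ℝ) + 1)) atTop (𝓝 0) :=
    tendsto_one_div_add_atTop_nhds_zero_nat
  have hanti : ∀ c : ℝ, Antitone fun j : ℕ => c + 1 / ((j : ℝ) + 1) := fun c i j hij =>
    add_le_add_right (Nat.one_div_le_one_div hij) c
  have hlim' : ∀ c : ℝ, Tendsto (fun j : ℕ => c + 1 / ((j : ℝ) + 1)) atTop (𝓝 c) := fun c => by
    simpa using hlim.const_add c
  choose RB hRB using fun j => hB _ (hpos j)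
  choose RV hRV using fun j => hV _ (hpos j)
  choose RW hRW using fun j => hW _ (hpos j)
  -- The entry `r + 1 + j` forces `R j > r` and `R j → ∞`; the others make all three pointwise
  -- bounds valid with error `1/(j+1)`.
  set R : ℕ → ℝ := fun j => max (r + 1 + j) (max (RB j) (max (RV j) (RW j))) with hR
  have hrR : ∀ j, r < R j := fun j =>
    lt_of_lt_of_le (by have := j.cast_nonneg (α := ℝ); linarith) (le_max_left _ _)
  -- Bounding `|F|` rather than `|F|²` produces the constant in the squared form `βⱼ²` and `ω₁ⱼ²`.
  have hsq : ∀ {F : E d → E d}, AEStronglyMeasurable F volume → ∀ {c ρ : ℝ} {φ : E d → ℂ},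
      (∀ᵐ x : E d, ρ ≤ ‖x‖ → ‖F x‖ ≤ c) → MemLp φ 2 volume → SuppOutside ρ φ →
      InFormDomain (fun x => ‖F x‖ ^ 2) φ ∧
        potentialForm (fun x => ‖F x‖ ^ 2) φ ≤ c ^ 2 * normSq2 φ := by
    intro F hF c ρ φ hb hφ hs
    have hb2 : ∀ᵐ x : E d, ρ ≤ ‖x‖ → |‖F x‖ ^ 2| ≤ c ^ 2 := hb.mono fun x hx hxR => by
      rw [abs_of_nonneg (by positivity)]
      exact pow_le_pow_left₀ (norm_nonneg _) (hx hxR) 2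
    have hd := inFormDomain_of_bounded (hF.norm.pow 2).restrict hb2 hφ hs
    exact ⟨hd, potentialForm_le (hb2.mono fun x hx h => (le_abs_self _).trans (hx h)) hφ hs hd⟩
  refine ⟨fun j => 1 / ((j : ℝ) + 1), fun j => β + 1 / ((j : ℝ) + 1),
    fun j => ω₁ + 1 / ((j : ℝ) + 1), fun j => ω₂ + 1 / ((j : ℝ) + 1), R, r, potentialForm W,
    fun j => ⟨hpos j, add_pos_of_nonneg_of_pos hβ (hpos j), add_pos_of_nonneg_of_pos hω₁ (hpos j),
      add_pos_of_nonneg_of_pos hω₂ (hpos j), hr.trans (hrR j)⟩, hlim, ?_, hanti β, hlim' β,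
    hanti ω₁, hlim' ω₁, hanti ω₂, hlim' ω₂, hr, hq, hrR, fun j φ ψ hφ hs => ?_⟩
  · exact tendsto_atTop_mono (fun j => le_max_left _ _)
      (tendsto_atTop_add_const_left _ _ tendsto_natCast_atTop_atTop)
  · have hψ : 0 ≤ 1 / ((j : ℝ) + 1) * normSq2 ψ := mul_nonneg (hpos j).le (normSq2_nonneg ψ)
    have h1 := hsq hBm (hRB j) hφ.memLp
      (hs.mono ((le_max_left _ _).trans (le_max_right _ _)))
    have h2 := hsq hVm (hRV j) hφ.memLp
      (hs.mono (((le_max_left _ _).trans (le_max_right _ _)).trans (le_max_right _ _)))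
    have h3 := potentialForm_le (hRW j) hφ.memLp
      (hs.mono (((le_max_right _ _).trans (le_max_right _ _)).trans (le_max_right _ _)))
      (inFormDomain_of_bounded hWm hWC hφ.memLp (hs.mono (hrR j).le))
    exact ⟨⟨h1.1, by linarith [h1.2]⟩, ⟨h2.1, by linarith [h2.2]⟩, by linarith⟩

end MagneticForms


/-! ### Assembly -/

theorem corollary5 (d : ℕ) (hd : 2 ≤ d) (B : E d → Matrix (Fin d) (Fin d) ℝ)
    (hB_meas : ∀ i j, AEStronglyMeasurable (fun x => B x i j) volume)
    (hB_anti : ∀ x, (B x).transpose = -B x)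
    (hB_int : MildlyIntegrable B)
    (V V₁ V₂ W : E d → ℝ)
    (hV₁_loc : LocallyIntegrable V₁ volume) (hV₂_loc : LocallyIntegrable V₂ volume)
    (hV : ∀ x, V x = V₁ x + V₂ x)
    (hW : IsVirialOutsideCompact V₂ W)
    (hB_bdd : BoundedOutsideCompact (fun x => ‖tildeB B x‖ ^ 2))
    (hV_bdd : BoundedOutsideCompact V)
    (hV₁_bdd : BoundedOutsideCompact V₁)
    (hxV₁_bdd : BoundedOutsideCompact (fun x => V₁ x • x))
    (hW_bdd : BoundedOutsideCompact W)
    (hV_lim : Tendsto V (essAtInfinity d) (𝓝 0))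
    (hV₁_lim : Tendsto V₁ (essAtInfinity d) (𝓝 0)) :
    (VanishesAtInfinity (poincareGauge B) V ∧ VanishesAtInfinity (poincareGauge B) V₁) ∧
    (∃ β ω₁ ω₂ : ℝ,
      FieldAndVirialBoundedAtInfinity (poincareGauge B) B V₁ V₂ β ω₁ ω₂ ∧
      β ≤ essLimsupAtInfinity (fun x => ‖tildeB B x‖) ∧
      ω₁ ≤ essLimsupAtInfinity (fun x => ‖V₁ x • x‖) ∧
      ω₂ ≤ essLimsupAtInfinity (fun x => max (W x) 0)) ∧
    (BoundedAtInfinity (poincareGauge B) (fun x => ‖tildeB B x‖ ^ 2) ∧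
      Real.sqrt (asymptoticBound (poincareGauge B) (fun x => ‖tildeB B x‖ ^ 2))
        ≤ essLimsupAtInfinity (fun x => ‖tildeB B x‖)) ∧
    (BoundedAtInfinity (poincareGauge B) (fun x => ‖V₁ x • x‖ ^ 2) ∧
      Real.sqrt (asymptoticBound (poincareGauge B) (fun x => ‖V₁ x • x‖ ^ 2))
        ≤ essLimsupAtInfinity (fun x => ‖V₁ x • x‖)) ∧
    (VirialBoundedAboveAtInfinity (poincareGauge B) V₂ ∧
      virialAsymptoticUpperBound (poincareGauge B) V₂
        ≤ essLimsupAtInfinity (fun x => max (W x) 0)) := by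
  have hBm := aestronglyMeasurable_tildeB hB_meas
  have hV₁m := hV₁_loc.aestronglyMeasurable
  have hVm : AEStronglyMeasurable V volume := by
    rw [show V = fun x => V₁ x + V₂ x from funext hV]
    exact hV₁m.add hV₂_loc.aestronglyMeasurable
  have hxV₁m : AEStronglyMeasurable (fun x : E d => V₁ x • x) volume :=
    hV₁m.smul aestronglyMeasurable_id
  obtain ⟨RB, CB, hRB, hCB⟩ := hB_bdd.exists_bound
  have hCB' : ∀ᵐ x : E d, RB ≤ ‖x‖ → ‖tildeB B x‖ ≤ Real.sqrt CB := hCB.mono fun x hx hxR =>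
    Real.le_sqrt_of_sq_le (by simpa using hx hxR)
  obtain ⟨RV, CV, hRV, hCV⟩ := hxV₁_bdd.exists_bound
  obtain ⟨r, C, hr, hWm, hWC, hq⟩ :=
    isVirialFormOutside_potentialForm (poincareGauge B) hV₂_loc hW hW_bdd
  have hWC' : ∀ᵐ x : E d, r ≤ ‖x‖ → max (W x) 0 ≤ C := hWC.mono fun x hx hxr =>
    (max_le (le_abs_self _) (abs_nonneg _)).trans (hx hxr)
  -- Passing through the positive part of `W` gives a nonnegative limit, as positive `γ_R` require.
  have hWess := (essLeAtInfinity_essLimsup hWC').of_max_zero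
  have hω₂ : 0 ≤ essLimsupAtInfinity (fun x => max (W x) 0) :=
    essLimsupAtInfinity_nonneg fun x => le_max_right _ _
  have hmem : essLimsupAtInfinity (fun x => max (W x) 0) ∈
      virialUpperBoundsAtInfinity (poincareGauge B) V₂ := by
    -- The extension lives outside radius `r`, and the form bound must start strictly beyond it.
    refine ⟨r, r + 1, potentialForm W, hr, by linarith, hq, ?_⟩
    refine formBoundAtInfinity_potentialForm _ (by linarith) hω₂ (hWm.mono_measure
      (Measure.restrict_mono (fun x hx => ?_) le_rfl)) (ae_outside_mono (by linarith) hWC) hWess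
    exact (show r ≤ r + 1 by linarith).trans hx
  refine ⟨⟨vanishesAtInfinity_of_tendsto _ hVm hV_bdd hV_lim,
    vanishesAtInfinity_of_tendsto _ hV₁m hV₁_bdd hV₁_lim⟩,
    -- The witnesses for `β`, `ω₁`, `ω₂` are the three limsups themselves.
    ⟨_, _, _, fieldAndVirialBoundedAtInfinity _
      (essLimsupAtInfinity_nonneg fun x => norm_nonneg _)
      (essLimsupAtInfinity_nonneg fun x => norm_nonneg _) hω₂ hBm hxV₁m hr hWm hWC hq
      (essLeAtInfinity_essLimsup hCB') (essLeAtInfinity_essLimsup hCV) hWess,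
      le_rfl, le_rfl, le_rfl⟩,
    boundedAtInfinity_norm_sq _ hBm hRB hCB', boundedAtInfinity_norm_sq _ hxV₁m hRV hCV,
    ⟨_, hmem⟩, csInf_le ⟨0, ?_⟩ hmem⟩
  rintro c ⟨_, _, _, _, _, _, hb⟩
  exact hb.nonneg
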